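/- Let $E_1(t)=1-\ln t$ and $E_2(t)=\ln(eE_1(t))$ for $t\in(0,1]$. Let $\Omega\subset\mathbb R^4$ be a bounded domain (a bounded connected open set) containing the origin, put $R_\Omega=\sup_{x\in\Omega}|x|$, and let $R\ge R_\Omega$. Here $C_0^\infty(\Omega\setminus\{0\})$ denotes the real-valued smooth functions with compact support in $\Omega\setminus\{0\}$. 1. For every $u\in C_0^\infty(\Omega\setminus\{0\})$, $$\int_\Omega(\Delta u)^2\,dx-\int_\Omega\frac{|u|^2}{|x|^4E_1^2\left(\frac{|x|}R\right)}\,dx\ \ge\ \int_\Omega\frac{|u|^2}{|x|^4E_1^2\left(\frac{|x|}R\right)E_2^2\left(\frac{|x|}R\right)}\,dx.\qquad(*)$$ 2. Let $D>0$ and $\gamma\in\mathbb R$ be such that $$\int_\Omega(\Delta u)^2\,dx-\int_\Omega\frac{|u|^2}{|x|^4E_1^2\left(\frac{|x|}R\right)}\,dx\ \ge\ D\int_\Omega\frac{|u|^2}{|x|^4E_1^2\left(\frac{|x|}R\right)E_2^\gamma\left(\frac{|x|}R\right)}\,dx$$ for all $u\in C_0^\infty(\Omega\setminus\{0\})$.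 Then $\gamma\ge 2$; and if $\gamma=2$, then $D\le 1$. 3. Consequently, $1$ is the best constant on the right-hand side of $(*)$: it is the largest $D\in\mathbb R$ such that, for all $u\in C_0^\infty(\Omega\setminus\{0\})$, the left-hand side of $(*)$ is at least $D$ times its right-hand side. -/

import Mathlib

open MeasureTheory
open scoped ContDiff Laplacian

/-- Four-dimensional Euclidean space. -/
abbrev R4 : Type := EuclideanSpace ℝ (Fin 4)

/-- `R_Ω = sup_{x ∈ Ω} |x|`. -/
noncomputable def outerRadius (Ω : Set R4) : ℝ :=
  sSup ((fun x : R4 => ‖x‖) '' Ω)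

/-- `E₁(t) = 1 - ln t`, used for `t ∈ (0, 1]`. -/
noncomputable def E₁ (t : ℝ) : ℝ := 1 - Real.log t

/-- `E₂(t) = ln (e E₁(t))`, used for `t ∈ (0, 1]`. -/
noncomputable def E₂ (t : ℝ) : ℝ := Real.log (Real.exp 1 * E₁ t)

/-- `u ∈ C₀^∞(U)`: a real-valued smooth function on `ℝ⁴` whose support is a compact subset
of `U`. -/
structure IsTestFunction (U : Set R4) (u : R4 → ℝ) : Prop where
  contDiff : ContDiff ℝ ∞ u
  hasCompactSupport : HasCompactSupport u
  tsupport_subset : tsupport u ⊆ U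

/-! The inequality comes from integrating a divergence. In dimension four `rellichField u G` has a
divergence free of the full gradient: writing `e` for the Euler derivative x·∇u and ρ for |x|⁻², one
has (Δu)² − 4 div = (Δu − 2eρ)² + 4ρ²(e + Gu)² + 4(G′ − G²)ρ²u². The divergence integrates to zero,
so every G gives a Rellich inequality with weight 4(G′ − G²) in log |x|
(`integral_weight_le_integral_laplacian_sq`). The choice `hardyMultiplier` turns this weight into
the sum of the two weights in (*).

For sharpness, take u radial, u = v(s) with s = E₁(|x|/R). The hypothesis becomes an inequality on
the line whose right side is ∫v″² + 4∫v′² (`line_inequality_of_rellich`). Substituting v(s) = (s(1 +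
log s))^{1/2} k(log(1 + log s)) is exact: 4∫v′² equals the Hardy term plus ∫k² + 4∫k′², and the
D-term becomes D∫exp((2 − γ)y)k². The term ∫v″² is negligible when k lives far out. Stretching a
fixed bump, k(y) = h(y/M) with M → ∞, also makes ∫k′² negligible against ∫k², leaving D exp((2 −
γ)M) ≤ 1 + o(1) when γ ≤ 2 (`scaled_line_inequality`). -/

/-- The `i`-th standard basis vector of `ℝ⁴`. -/
noncomputable abbrev stdVec (i : Fin 4) : R4 := EuclideanSpace.single i (1 : ℝ)

/-- The `i`-th partial derivative of a function on `ℝ⁴`. -/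
noncomputable def pd (i : Fin 4) (f : R4 → ℝ) (x : R4) : ℝ := fderiv ℝ f x (stdVec i)

/-! ### Rules for partial derivatives on ℝ⁴. -/

/-- `f` is differentiable at `x` and its `i`-th partial derivative there is `c`. -/
structure HasPd (i : Fin 4) (f : R4 → ℝ) (c : ℝ) (x : R4) : Prop where
  diff : DifferentiableAt ℝ f x
  eq : pd i f x = c

namespace HasPd

variable {i : Fin 4} {f g : R4 → ℝ} {c d : ℝ} {x : R4}

theorem congr_val (h : HasPd i f c x) (hcd : c = d) : HasPd i f d x := hcd ▸ h

theorem of_hasFDerivAt {L : R4 →L[ℝ] ℝ} (h : HasFDerivAt f L x) : HasPd i f (L (stdVec i)) x :=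
  ⟨h.differentiableAt, by rw [pd, h.fderiv]⟩

theorem of_differentiableAt (h : DifferentiableAt ℝ f x) : HasPd i f (pd i f x) x := ⟨h, rfl⟩

theorem hasFDerivAt (h : HasPd i f c x) : HasFDerivAt f (fderiv ℝ f x) x := h.diff.hasFDerivAt

theorem add (hf : HasPd i f c x) (hg : HasPd i g d x) : HasPd i (fun y => f y + g y) (c + d) x :=
  (of_hasFDerivAt (hf.hasFDerivAt.add hg.hasFDerivAt)).congr_val (by
    rw [← hf.eq, ← hg.eq]; rfl)

theorem sub (hf : HasPd i f c x) (hg : HasPd i g d x) : HasPd i (fun y => f y - g y) (c - d) x :=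
  (of_hasFDerivAt (hf.hasFDerivAt.sub hg.hasFDerivAt)).congr_val (by
    rw [← hf.eq, ← hg.eq]; rfl)

theorem mul (hf : HasPd i f c x) (hg : HasPd i g d x) :
    HasPd i (fun y => f y * g y) (c * g x + f x * d) x :=
  (of_hasFDerivAt (hf.hasFDerivAt.mul hg.hasFDerivAt)).congr_val (by
    rw [← hf.eq, ← hg.eq]; simp [pd]; ring)

theorem const (a : ℝ) : HasPd i (fun _ => a) 0 x :=
  (of_hasFDerivAt (hasFDerivAt_const a x)).congr_val (by simp)

theorem comp {φ : ℝ → ℝ} {φ' : ℝ} (hφ : HasDerivAt φ φ' (f x)) (hf : HasPd i f c x) :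
    HasPd i (fun y => φ (f y)) (φ' * c) x :=
  (of_hasFDerivAt (hφ.comp_hasFDerivAt x hf.hasFDerivAt)).congr_val (by
    rw [← hf.eq]; simp [pd])

theorem sum {ι : Type*} {s : Finset ι} {F : ι → R4 → ℝ} {C : ι → ℝ}
    (h : ∀ j ∈ s, HasPd i (F j) (C j) x) :
    HasPd i (fun y => ∑ j ∈ s, F j y) (∑ j ∈ s, C j) x :=
  (of_hasFDerivAt (HasFDerivAt.fun_sum fun j hj => (h j hj).hasFDerivAt)).congr_val (by
    rw [_root_.sum_apply]
    exact Finset.sum_congr rfl fun j hj => (h j hj).eq)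

theorem coord (j : Fin 4) : HasPd i (fun y : R4 => y j) (if j = i then 1 else 0) x :=
  (of_hasFDerivAt (EuclideanSpace.proj j : R4 →L[ℝ] ℝ).hasFDerivAt).congr_val
    (by simp [stdVec])

theorem norm_sq : HasPd i (fun y : R4 => ‖y‖ ^ 2) (2 * x i) x :=
  (of_hasFDerivAt (hasStrictFDerivAt_norm_sq x).hasFDerivAt).congr_val (by
    simp [stdVec, EuclideanSpace.inner_single_right])

theorem inv_norm_sq (hx : x ≠ 0) :
    HasPd i (fun y : R4 => (‖y‖ ^ 2)⁻¹) (-2 * x i * ((‖x‖ ^ 2)⁻¹) ^ 2) x :=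
  (comp (hasDerivAt_inv (by simpa using hx)) norm_sq).congr_val (by
    have : ‖x‖ ≠ 0 := by simpa using hx
    field_simp)

theorem log_norm (hx : x ≠ 0) :
    HasPd i (fun y : R4 => Real.log ‖y‖) (x i * (‖x‖ ^ 2)⁻¹) x := by
  have hx' : ‖x‖ ≠ 0 := by simpa using hx
  have h := (comp ((Real.hasDerivAt_log (pow_ne_zero 2 hx')).const_mul (1 / 2))
    (norm_sq (i := i) (x := x)))
  have e : (fun y : R4 => 1 / 2 * Real.log (‖y‖ ^ 2)) = fun y => Real.log ‖y‖ := by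
    ext y; rw [Real.log_pow]; push_cast; ring
  rw [e] at h
  exact h.congr_val (by field_simp)

theorem congr_of_eventuallyEq (h : HasPd i f c x) (hfg : g =ᶠ[nhds x] f) : HasPd i g c x :=
  ⟨h.diff.congr_of_eventuallyEq hfg, by rw [pd, hfg.fderiv_eq]; exact h.eq⟩

end HasPd

/-! ### The Laplacian, supports, and vanishing integrals of partial derivatives. -/

theorem ContDiff.pd_infty {f : R4 → ℝ} (hf : ContDiff ℝ ∞ f) (i : Fin 4) :
    ContDiff ℝ ∞ (_root_.pd i f) :=
  (hf.fderiv_right (by norm_cast)).clm_apply contDiff_const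

theorem pd_comm {f : R4 → ℝ} (hf : ContDiff ℝ ∞ f) (i j : Fin 4) (x : R4) :
    pd i (pd j f) x = pd j (pd i f) x := by
  have hd : DifferentiableAt ℝ (fderiv ℝ f) x :=
    ((hf.fderiv_right (m := 1) (by norm_cast)).differentiable (by simp)) x
  have key : ∀ i j : Fin 4, pd i (pd j f) x = fderiv ℝ (fderiv ℝ f) x (stdVec i) (stdVec j) := by
    intro i j
    have := (hd.hasFDerivAt.clm_apply (hasFDerivAt_const (stdVec j) x)).fderiv
    change fderiv ℝ (fun y => fderiv ℝ f y (stdVec j)) x (stdVec i) = _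
    rw [this]; simp
  rw [key, key]
  exact (hf.contDiffAt.isSymmSndFDerivAt (by simp; norm_cast)) _ _

theorem laplacian_eq_sum_pd {f : R4 → ℝ} {x : R4} (hf : ContDiffAt ℝ 2 f x) :
    Δ f x = ∑ i, pd i (pd i f) x := by
  rw [InnerProductSpace.laplacian_eq_iteratedFDeriv_orthonormalBasis f
    (EuclideanSpace.basisFun (Fin 4) ℝ)]
  refine Finset.sum_congr rfl fun i _ => ?_
  have hd : DifferentiableAt ℝ (fderiv ℝ f) x :=
    (hf.fderiv_right (m := 1) (by norm_num)).differentiableAt (by simp)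
  have := (hd.hasFDerivAt.clm_apply (hasFDerivAt_const (stdVec i) x)).fderiv
  change _ = fderiv ℝ (fun y => fderiv ℝ f y (stdVec i)) x (stdVec i)
  rw [this, iteratedFDeriv_two_apply]; simp

theorem HasCompactSupport.pd {f : R4 → ℝ} (hf : HasCompactSupport f) (i : Fin 4) :
    HasCompactSupport (pd i f) :=
  (hf.fderiv ℝ).comp_left (g := fun L : R4 →L[ℝ] ℝ => L (stdVec i)) (by simp)

theorem integral_pd_eq_zero {f : R4 → ℝ} (hf : ContDiff ℝ 1 f) (hc : HasCompactSupport f)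
    (i : Fin 4) : ∫ x, pd i f x = 0 := by
  have hpd : Continuous (pd i f) :=
    (hf.continuous_fderiv (by simp)).clm_apply continuous_const
  have h := integral_mul_fderiv_eq_neg_fderiv_mul_of_integrable (𝕜 := ℝ) (μ := volume)
    (f := fun _ : R4 => (1 : ℝ)) (g := f) (v := stdVec i) (by simp)
    (by simp only [one_mul]; exact hpd.integrable_of_hasCompactSupport (hc.pd i))
    (by simp only [one_mul]; exact hf.continuous.integrable_of_hasCompactSupport hc)
    (by fun_prop) (fun x _ => hf.differentiable (by simp) x)
  simpa [pd] using h

theorem pd_eq_zero_of_notMem_tsupport {f : R4 → ℝ} {x : R4} (hx : x ∉ tsupport f) (i : Fin 4) :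
    pd i f x = 0 := by
  have : fderiv ℝ f x = 0 :=
    Function.notMem_support.1 fun h => hx (support_fderiv_subset ℝ h)
  simp [pd, this]

theorem laplacian_eq_zero_of_notMem_tsupport {f : R4 → ℝ} {x : R4} (hx : x ∉ tsupport f) :
    Δ f x = 0 := by
  have h : f =ᶠ[nhds x] fun _ => 0 := notMem_tsupport_iff_eventuallyEq.1 hx
  rw [(InnerProductSpace.laplacian_congr_nhds h).eq_of_nhds]
  exact congrFun (InnerProductSpace.laplacian_const (E := R4) (c := (0 : ℝ))) x

theorem ContDiff.continuous_laplacian {f : R4 → ℝ} (hf : ContDiff ℝ ∞ f) :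
    Continuous (Δ f) := by
  have : Δ f = fun x => ∑ i, _root_.pd i (_root_.pd i f) x :=
    funext fun x => laplacian_eq_sum_pd (hf.of_le (by norm_cast)).contDiffAt
  rw [this]
  exact continuous_finsetSum _ fun i _ => ((hf.pd_infty i).pd_infty i).continuous

/-- A function which vanishes off the support of the compactly supported `u` and is smooth along
that support is smooth and compactly supported. -/
theorem contDiff_hasCompactSupport_of_tsupport {n : WithTop ℕ∞} {u F : R4 → ℝ}
    (hu : HasCompactSupport u) (h0 : ∀ x, x ∉ tsupport u → F x = 0)
    (hF : ∀ x ∈ tsupport u, ContDiffAt ℝ n F x) :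
    ContDiff ℝ n F ∧ HasCompactSupport F ∧ tsupport F ⊆ tsupport u := by
  have hs : tsupport F ⊆ tsupport u :=
    closure_minimal (fun x hx => by_contra fun h => hx (h0 x h)) (isClosed_tsupport u)
  refine ⟨contDiff_iff_contDiffAt.2 fun x => ?_,
    hu.of_isClosed_subset (isClosed_tsupport F) hs, hs⟩
  by_cases hx : x ∈ tsupport F
  · exact hF x (hs hx)
  · exact contDiffAt_const.congr_of_eventuallyEq (notMem_tsupport_iff_eventuallyEq.1 hx)

/-! ### The Rellich inequality with a general radial weight. -/

/-- The vector field whose divergence produces the Rellich inequality with radial weight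
`4 (G' - G²)`. -/
noncomputable def rellichField (u : R4 → ℝ) (G : ℝ → ℝ) (i : Fin 4) (x : R4) : ℝ :=
  (pd i u x * (∑ j, x j * pd j u x)) * (‖x‖ ^ 2)⁻¹
    - (x i * (‖x‖ ^ 2)⁻¹) * ((∑ j, pd j u x * pd j u x) * (1 / 2))
    - (G (Real.log ‖x‖) * (u x * u x)) * (x i * ((‖x‖ ^ 2)⁻¹ * (‖x‖ ^ 2)⁻¹))

theorem hasPd_rellichField {u : R4 → ℝ} (hu : ContDiff ℝ ∞ u) {G : ℝ → ℝ} {g' : ℝ} {x : R4}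
    (hx : x ≠ 0) (hG : HasDerivAt G g' (Real.log ‖x‖)) (i : Fin 4) :
    HasPd i (rellichField u G i)
      ((pd i (pd i u) x * (∑ j, x j * pd j u x)
          + pd i u x * (∑ j, ((if j = i then 1 else 0) * pd j u x + x j * pd i (pd j u) x)))
            * (‖x‖ ^ 2)⁻¹
        + (pd i u x * (∑ j, x j * pd j u x)) * (-2 * x i * ((‖x‖ ^ 2)⁻¹) ^ 2)
        - ((1 * (‖x‖ ^ 2)⁻¹ + x i * (-2 * x i * ((‖x‖ ^ 2)⁻¹) ^ 2))
              * ((∑ j, pd j u x * pd j u x) * (1 / 2))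
            + (x i * (‖x‖ ^ 2)⁻¹)
              * ((∑ j, (pd i (pd j u) x * pd j u x + pd j u x * pd i (pd j u) x)) * (1 / 2)))
        - ((g' * (x i * (‖x‖ ^ 2)⁻¹) * (u x * u x)
              + G (Real.log ‖x‖) * (pd i u x * u x + u x * pd i u x))
              * (x i * ((‖x‖ ^ 2)⁻¹ * (‖x‖ ^ 2)⁻¹))
            + (G (Real.log ‖x‖) * (u x * u x)) * (1 * ((‖x‖ ^ 2)⁻¹ * (‖x‖ ^ 2)⁻¹)
              + x i * ((-2 * x i * ((‖x‖ ^ 2)⁻¹) ^ 2) * (‖x‖ ^ 2)⁻¹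
                + (‖x‖ ^ 2)⁻¹ * (-2 * x i * ((‖x‖ ^ 2)⁻¹) ^ 2))))) x := by
  have hρ := HasPd.inv_norm_sq (i := i) hx
  have hu0 : HasPd i u (pd i u x) x :=
    .of_differentiableAt (hu.differentiable (by simp) x)
  have hu1 : ∀ j, HasPd i (pd j u) (pd i (pd j u) x) x := fun j =>
    .of_differentiableAt ((hu.pd_infty j).differentiable (by simp) x)
  have hxi : HasPd i (fun y : R4 => y i) 1 x := (HasPd.coord i).congr_val (by simp)
  have hg : HasPd i (fun y => G (Real.log ‖y‖)) (g' * (x i * (‖x‖ ^ 2)⁻¹)) x :=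
    HasPd.comp (f := fun y : R4 => Real.log ‖y‖) hG (HasPd.log_norm hx)
  have hgrad : HasPd i (fun y => (∑ j, pd j u y * pd j u y) * (1 / 2)) _ x :=
    (HasPd.sum fun j _ => (hu1 j).mul (hu1 j)).mul (HasPd.const (1 / 2))
  have heul : HasPd i (fun y => ∑ j, y j * pd j u y) _ x :=
    HasPd.sum fun j _ => (HasPd.coord j).mul (hu1 j)
  exact (((((hu1 i).mul heul).mul hρ).sub ((hxi.mul hρ).mul hgrad)).sub
    ((hg.mul (hu0.mul hu0)).mul (hxi.mul (hρ.mul hρ)))).congr_val (by simp only [mul_zero, add_zero])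

/-- Two cancellations are special to dimension four. The |∇u|²|x|⁻² coming from ∇u·∇(x·∇u) cancels
against half the divergence of x|x|⁻², which is |x|⁻²; and x|x|⁻⁴ is divergence free, so G is never
left undifferentiated next to u². -/
theorem sum_pd_rellichField {u : R4 → ℝ} (hu : ContDiff ℝ ∞ u) {G : ℝ → ℝ} {g' : ℝ} {x : R4}
    (hx : x ≠ 0) (hG : HasDerivAt G g' (Real.log ‖x‖)) :
    ∑ i, pd i (rellichField u G i) x =
      Δ u x * (∑ j, x j * pd j u x) * (‖x‖ ^ 2)⁻¹
        - 2 * (∑ j, x j * pd j u x) ^ 2 * ((‖x‖ ^ 2)⁻¹) ^ 2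
        - g' * u x ^ 2 * ((‖x‖ ^ 2)⁻¹) ^ 2
        - 2 * G (Real.log ‖x‖) * u x * (∑ j, x j * pd j u x) * ((‖x‖ ^ 2)⁻¹) ^ 2 := by
  have hq : (‖x‖ ^ 2)⁻¹ * ∑ j, x j ^ 2 = 1 := by
    have h : ‖x‖ ^ 2 = ∑ j, x j ^ 2 := by
      rw [EuclideanSpace.norm_sq_eq]; simp
    rw [← h]; exact inv_mul_cancel₀ (pow_ne_zero 2 (norm_ne_zero_iff.2 hx))
  rw [Finset.sum_congr rfl fun i _ => (hasPd_rellichField hu hx hG i).eq,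
    laplacian_eq_sum_pd (hu.of_le (by norm_cast)).contDiffAt]
  have c10 := pd_comm hu 1 0 x
  have c20 := pd_comm hu 2 0 x
  have c30 := pd_comm hu 3 0 x
  have c21 := pd_comm hu 2 1 x
  have c31 := pd_comm hu 3 1 x
  have c32 := pd_comm hu 3 2 x
  generalize (‖x‖ ^ 2)⁻¹ = ρ at *
  simp only [Fin.sum_univ_four] at *
  simp only [c10, c20, c30, c21, c31, c32]
  simp only [Fin.reduceEq, if_true, if_false]
  -- After symmetrising the mixed derivatives, the two sides differ only by multiples of |x|⁻²∑xⱼ² −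
  -- 1.
  linear_combination
    (ρ * (pd 0 u x * pd 0 u x + pd 1 u x * pd 1 u x + pd 2 u x * pd 2 u x + pd 3 u x * pd 3 u x)
      - g' * ρ ^ 2 * u x ^ 2 + 4 * G (Real.log ‖x‖) * u x ^ 2 * ρ ^ 2) * hq

theorem contDiffAt_log_norm {n : WithTop ℕ∞} {x : R4} (hx : x ≠ 0) :
    ContDiffAt ℝ n (fun y : R4 => Real.log ‖y‖) x :=
  (contDiffAt_norm ℝ hx).log (norm_ne_zero_iff.2 hx)

theorem contDiffAt_inv_norm_sq {n : WithTop ℕ∞} {x : R4} (hx : x ≠ 0) :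
    ContDiffAt ℝ n (fun y : R4 => (‖y‖ ^ 2)⁻¹) x :=
  ((contDiff_norm_sq ℝ).contDiffAt).inv (pow_ne_zero 2 (norm_ne_zero_iff.2 hx))

theorem contDiff_rellichField {u : R4 → ℝ} (hu : ContDiff ℝ ∞ u) (hc : HasCompactSupport u)
    (h0 : ∀ x ∈ tsupport u, x ≠ 0) {G : ℝ → ℝ}
    (hG : ∀ x ∈ tsupport u, ContDiffAt ℝ ∞ G (Real.log ‖x‖)) (i : Fin 4) :
    ContDiff ℝ ∞ (rellichField u G i) ∧ HasCompactSupport (rellichField u G i) ∧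
      tsupport (rellichField u G i) ⊆ tsupport u := by
  refine contDiff_hasCompactSupport_of_tsupport hc (fun x hx => ?_) fun x hx => ?_
  · simp [rellichField, pd_eq_zero_of_notMem_tsupport hx, image_eq_zero_of_notMem_tsupport hx]
  · have hρ := contDiffAt_inv_norm_sq (n := ∞) (h0 x hx)
    have hpd : ∀ j, ContDiffAt ℝ ∞ (pd j u) x := fun j => (hu.pd_infty j).contDiffAt
    have hcoord : ∀ j, ContDiffAt ℝ ∞ (fun y : R4 => y j) x := fun j =>
      (EuclideanSpace.proj j : R4 →L[ℝ] ℝ).contDiff.contDiffAt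
    have hg : ContDiffAt ℝ ∞ (fun y : R4 => G (Real.log ‖y‖)) x :=
      (hG x hx).comp x (contDiffAt_log_norm (h0 x hx))
    have hu' := hu.contDiffAt (x := x)
    exact ((((hpd i).mul (ContDiffAt.sum fun j _ => (hcoord j).mul (hpd j))).mul hρ).sub
      (((hcoord i).mul hρ).mul
        ((ContDiffAt.sum fun j _ => (hpd j).mul (hpd j)).mul contDiffAt_const))).sub
      ((hg.mul (hu'.mul hu')).mul ((hcoord i).mul (hρ.mul hρ)))

/-- A Rellich inequality in dimension four with a general radial weight. -/
theorem integral_weight_le_integral_laplacian_sq {u : R4 → ℝ} (hu : ContDiff ℝ ∞ u)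
    (hc : HasCompactSupport u) (h0 : ∀ x ∈ tsupport u, x ≠ 0) {G W : ℝ → ℝ}
    (hG : ∀ x ∈ tsupport u, ContDiffAt ℝ ∞ G (Real.log ‖x‖))
    (hW : ∀ x ∈ tsupport u, HasDerivAt G
      (W (Real.log ‖x‖) / 4 + G (Real.log ‖x‖) ^ 2) (Real.log ‖x‖))
    (hint : Integrable fun x => W (Real.log ‖x‖) * u x ^ 2 * ((‖x‖ ^ 2)⁻¹) ^ 2) :
    ∫ x, W (Real.log ‖x‖) * u x ^ 2 * ((‖x‖ ^ 2)⁻¹) ^ 2 ≤ ∫ x, (Δ u x) ^ 2 := by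
  have hF := contDiff_rellichField hu hc h0 hG
  have hpdint : ∀ i, Integrable (pd i (rellichField u G i)) := fun i =>
    ((hF i).1.pd_infty i).continuous.integrable_of_hasCompactSupport ((hF i).2.1.pd i)
  have hdiv : ∫ x, ∑ i, pd i (rellichField u G i) x = 0 := by
    rw [integral_finsetSum _ fun i _ => hpdint i]
    exact Finset.sum_eq_zero fun i _ =>
      integral_pd_eq_zero ((hF i).1.of_le (by norm_cast)) (hF i).2.1 i
  have hdivint : Integrable fun x => ∑ i, pd i (rellichField u G i) x :=
    integrable_finsetSum _ fun i _ => hpdint i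
  have hΔ : Integrable fun x => (Δ u x) ^ 2 := by
    refine (hu.continuous_laplacian.pow 2).integrable_of_hasCompactSupport ?_
    refine hc.of_isClosed_subset (isClosed_tsupport _) (closure_minimal (fun x hx => ?_)
      (isClosed_tsupport u))
    by_contra h
    exact hx (by simp [laplacian_eq_zero_of_notMem_tsupport h])
  have key : ∫ x, (W (Real.log ‖x‖) * u x ^ 2 * ((‖x‖ ^ 2)⁻¹) ^ 2
      + 4 * ∑ i, pd i (rellichField u G i) x) ≤ ∫ x, (Δ u x) ^ 2 := by
    refine integral_mono (hint.add (hdivint.const_mul 4)) hΔ fun x => ?_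
    by_cases hx : x ∈ tsupport u
    · simp only
      rw [sum_pd_rellichField hu (h0 x hx) (hW x hx)]
      generalize (‖x‖ ^ 2)⁻¹ = ρ
      generalize ∑ j, x j * pd j u x = e
      -- Right minus left is exactly the first square plus four times the second.
      nlinarith [sq_nonneg (Δ u x - 2 * e * ρ),
        sq_nonneg (ρ * (e + G (Real.log ‖x‖) * u x))]
    · have : ∀ i, pd i (rellichField u G i) x = 0 := fun i =>
        pd_eq_zero_of_notMem_tsupport (fun h => hx ((hF i).2.2 h)) i
      simp [this, image_eq_zero_of_notMem_tsupport hx, sq_nonneg]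
  rwa [integral_add hint (hdivint.const_mul 4), integral_const_mul, hdiv, mul_zero, add_zero] at key

/-! ### The logarithmic weights, and passage from Ω to ℝ⁴. -/

theorem E₂_eq {t : ℝ} (ht : 0 < E₁ t) : E₂ t = 1 + Real.log (E₁ t) := by
  rw [E₂, Real.log_mul (Real.exp_ne_zero 1) ht.ne', Real.log_exp]

theorem one_le_E₁ {t : ℝ} (h0 : 0 < t) (h1 : t ≤ 1) : 1 ≤ E₁ t := by
  have := Real.log_nonpos h0.le h1
  rw [E₁]; linarith

theorem E₁_div {r R : ℝ} (hr : r ≠ 0) (hR : R ≠ 0) :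
    E₁ (r / R) = 1 + Real.log R - Real.log r := by
  rw [E₁, Real.log_div hr hR]; ring

theorem norm_le_of_outerRadius_le {Ω : Set R4} (hb : Bornology.IsBounded Ω) {R : ℝ}
    (hR : outerRadius Ω ≤ R) {x : R4} (hx : x ∈ Ω) : ‖x‖ ≤ R := by
  obtain ⟨C, hC⟩ := hb.exists_norm_le
  refine le_trans (le_csSup (s := (fun x : R4 => ‖x‖) '' Ω) ⟨C, ?_⟩ ⟨x, hx, rfl⟩) hR
  rintro _ ⟨y, hy, rfl⟩
  exact hC y hy

theorem exists_pos_norm_mem {Ω : Set R4} (ho : IsOpen Ω) (h0 : (0 : R4) ∈ Ω) :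
    ∃ ρ > 0, ∀ x : R4, ‖x‖ < ρ → x ∈ Ω := by
  obtain ⟨ρ, hρ, h⟩ := Metric.isOpen_iff.1 ho 0 h0
  exact ⟨ρ, hρ, fun x hx => h (by simpa using hx)⟩

theorem pos_of_outerRadius_le {Ω : Set R4} (ho : IsOpen Ω) (h0 : (0 : R4) ∈ Ω)
    (hb : Bornology.IsBounded Ω) {R : ℝ} (hR : outerRadius Ω ≤ R) : 0 < R := by
  obtain ⟨ρ, hρ, h⟩ := exists_pos_norm_mem ho h0
  have hn : ‖EuclideanSpace.single (0 : Fin 4) (ρ / 2)‖ = ρ / 2 := by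
    simp [abs_of_pos hρ]
  have := norm_le_of_outerRadius_le hb hR (h _ (by rw [hn]; linarith))
  rw [hn] at this
  linarith

theorem IsTestFunction.setIntegral_eq {Ω : Set R4} {u : R4 → ℝ} (hu : IsTestFunction (Ω \ {0}) u)
    {F : R4 → ℝ} (hF : ∀ x ∉ tsupport u, F x = 0) : ∫ x in Ω, F x = ∫ x, F x :=
  setIntegral_eq_integral_of_forall_compl_eq_zero fun _ hx =>
    hF _ fun h => hx (hu.tsupport_subset h).1

theorem IsTestFunction.integral_laplacian_eq {Ω : Set R4} {u : R4 → ℝ}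
    (hu : IsTestFunction (Ω \ {0}) u) : ∫ x in Ω, (Δ u x) ^ 2 = ∫ x, (Δ u x) ^ 2 :=
  hu.setIntegral_eq fun x hx => by simp [laplacian_eq_zero_of_notMem_tsupport hx]

/-! ### The inequality (*). -/

/-- The logarithmic derivative of `(s (1 + log s))^{1/2}`, at `s = L - y`. -/
noncomputable def hardyMultiplier (L y : ℝ) : ℝ :=
  1 / 2 * ((L - y)⁻¹ + (L - y)⁻¹ * (1 + Real.log (L - y))⁻¹)

/-- A Riccati equation: φ(s) = (s(1 + log s))^{1/2} solves φ″ + (W/4)φ = 0, with W the sum of the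
two weights. Since s = L − y reverses orientation, G = φ′/φ satisfies G′ = W/4 + G² in y. -/
theorem hasDerivAt_hardyMultiplier {L y : ℝ} (hs : L - y ≠ 0) (hE : 1 + Real.log (L - y) ≠ 0) :
    HasDerivAt (hardyMultiplier L)
      ((((L - y) ^ 2)⁻¹ + ((L - y) ^ 2 * (1 + Real.log (L - y)) ^ 2)⁻¹) / 4
        + hardyMultiplier L y ^ 2) y := by
  have h1 : HasDerivAt (fun z => L - z) (-1) y := by
    simpa using (hasDerivAt_id y).const_sub L
  have h2 := h1.inv hs
  have h3 := ((h1.log hs).const_add 1).inv hE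
  refine ((h2.add (h2.mul h3)).const_mul (1 / 2)).congr_deriv ?_
  simp only [hardyMultiplier, Pi.inv_apply]
  field_simp
  ring

theorem contDiffAt_hardyMultiplier {n : WithTop ℕ∞} {L y : ℝ} (hs : L - y ≠ 0)
    (hE : 1 + Real.log (L - y) ≠ 0) : ContDiffAt ℝ n (hardyMultiplier L) y := by
  have h1 : ContDiffAt ℝ n (fun z => L - z) y := by fun_prop
  have h2 := h1.inv hs
  have h3 := (contDiffAt_const (c := (1 : ℝ))).add (h1.log hs) |>.inv hE
  exact contDiffAt_const.mul (h2.add (h2.mul h3))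

theorem rellich_remainder {Ω : Set R4} (hopen : IsOpen Ω)
    (hbdd : Bornology.IsBounded Ω) (h0 : (0 : R4) ∈ Ω) {R : ℝ} (hR : outerRadius Ω ≤ R)
    {u : R4 → ℝ} (hu : IsTestFunction (Ω \ {0}) u) :
    (∫ x in Ω, |u x| ^ 2 / (‖x‖ ^ 4 * E₁ (‖x‖ / R) ^ 2)) +
      ∫ x in Ω, |u x| ^ 2 / (‖x‖ ^ 4 * E₁ (‖x‖ / R) ^ 2 * E₂ (‖x‖ / R) ^ 2) ≤
    ∫ x in Ω, (Δ u x) ^ 2 := by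
  have hRpos := pos_of_outerRadius_le hopen h0 hbdd hR
  have hx0 : ∀ x ∈ tsupport u, x ≠ 0 := fun x hx => (hu.tsupport_subset hx).2
  have hxR : ∀ x ∈ tsupport u, ‖x‖ ≤ R := fun x hx =>
    norm_le_of_outerRadius_le hbdd hR (hu.tsupport_subset hx).1
  have hnorm : ∀ x ∈ tsupport u, 0 < ‖x‖ := fun x hx => norm_pos_iff.2 (hx0 x hx)
  set L := 1 + Real.log R with hL
  have hE1 : ∀ x ∈ tsupport u, E₁ (‖x‖ / R) = L - Real.log ‖x‖ := fun x hx =>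
    E₁_div (hnorm x hx).ne' hRpos.ne'
  have hs1 : ∀ x ∈ tsupport u, 1 ≤ L - Real.log ‖x‖ := fun x hx => by
    rw [← hE1 x hx]
    exact one_le_E₁ (div_pos (hnorm x hx) hRpos) ((div_le_one hRpos).2 (hxR x hx))
  have hE2 : ∀ x ∈ tsupport u, E₂ (‖x‖ / R) = 1 + Real.log (L - Real.log ‖x‖) := fun x hx => by
    rw [E₂_eq (by rw [hE1 x hx]; linarith [hs1 x hx]), hE1 x hx]
  -- The bound |x| ≤ R keeps both logarithmic factors at least 1 on the support, so neither weight
  -- is singular there.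
  have ht1 : ∀ x ∈ tsupport u, 1 ≤ 1 + Real.log (L - Real.log ‖x‖) := fun x hx => by
    linarith [Real.log_nonneg (hs1 x hx)]
  have hint : ∀ w : ℝ → ℝ, (∀ x ∈ tsupport u, ContDiffAt ℝ 0 w (Real.log ‖x‖)) →
      Integrable fun x => w (Real.log ‖x‖) * u x ^ 2 * ((‖x‖ ^ 2)⁻¹) ^ 2 := by
    intro w hw
    have := contDiff_hasCompactSupport_of_tsupport (n := 0) hu.hasCompactSupport
      (F := fun x => w (Real.log ‖x‖) * u x ^ 2 * ((‖x‖ ^ 2)⁻¹) ^ 2)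
      (fun x hx => by simp [image_eq_zero_of_notMem_tsupport hx])
      (fun x hx => (((hw x hx).comp x (contDiffAt_log_norm (hx0 x hx))).mul
        ((hu.contDiff.contDiffAt.of_le (by simp)).pow 2)).mul
        ((contDiffAt_inv_norm_sq (hx0 x hx)).pow 2))
    exact this.1.continuous.integrable_of_hasCompactSupport this.2.1
  have hsne : ∀ x ∈ tsupport u, L - Real.log ‖x‖ ≠ 0 := fun x hx => by linarith [hs1 x hx]
  have htne : ∀ x ∈ tsupport u, 1 + Real.log (L - Real.log ‖x‖) ≠ 0 := fun x hx => by
    linarith [ht1 x hx]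
  have hc1 : ∀ x ∈ tsupport u,
      ContDiffAt ℝ 0 (fun y => ((L - y) ^ 2)⁻¹) (Real.log ‖x‖) := fun x hx =>
    ContDiffAt.inv (by fun_prop) (pow_ne_zero 2 (hsne x hx))
  have hc2 : ∀ x ∈ tsupport u, ContDiffAt ℝ 0
      (fun y => ((L - y) ^ 2 * (1 + Real.log (L - y)) ^ 2)⁻¹) (Real.log ‖x‖) := fun x hx =>
    have h1 : ContDiffAt ℝ 0 (fun y => L - y) (Real.log ‖x‖) := by fun_prop
    ((h1.pow 2).mul ((contDiffAt_const.add (h1.log (hsne x hx))).pow 2)).inv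
      (mul_ne_zero (pow_ne_zero 2 (hsne x hx)) (pow_ne_zero 2 (htne x hx)))
  have hi1 := hint _ hc1
  have hi2 := hint _ hc2
  have main := integral_weight_le_integral_laplacian_sq hu.contDiff hu.hasCompactSupport hx0
    (G := hardyMultiplier L)
    (W := fun y => ((L - y) ^ 2)⁻¹ + ((L - y) ^ 2 * (1 + Real.log (L - y)) ^ 2)⁻¹)
    (fun x hx => contDiffAt_hardyMultiplier (hsne x hx) (htne x hx))
    (fun x hx => hasDerivAt_hardyMultiplier (hsne x hx) (htne x hx))
    (by simp only [add_mul]; exact hi1.add hi2)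
  simp only [add_mul] at main
  rw [integral_add hi1 hi2] at main
  have hz : ∀ x ∉ tsupport u, u x = 0 := fun x hx => image_eq_zero_of_notMem_tsupport hx
  rw [hu.integral_laplacian_eq, hu.setIntegral_eq (fun x hx => by simp [hz x hx]),
    hu.setIntegral_eq (fun x hx => by simp [hz x hx])]
  convert main using 2
  · refine integral_congr_ae (.of_forall fun x => ?_)
    by_cases hx : x ∈ tsupport u
    · simp only [hE1 x hx, sq_abs]
      field_simp
    · simp [hz x hx]
  · refine integral_congr_ae (.of_forall fun x => ?_)
    by_cases hx : x ∈ tsupport u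
    · simp only [hE1 x hx, hE2 x hx, sq_abs]
      field_simp
    · simp [hz x hx]

/-! ### One-dimensional bumps and the Hardy substitution. -/

/-- A smooth function on the line which vanishes outside `[a, b]`. -/
structure IsBump (a b : ℝ) (k : ℝ → ℝ) : Prop where
  contDiff : ContDiff ℝ ∞ k
  eq_zero : ∀ x ∉ Set.Icc a b, k x = 0

namespace IsBump

variable {a b : ℝ} {k : ℝ → ℝ}

theorem hasCompactSupport (hk : IsBump a b k) : HasCompactSupport k :=
  HasCompactSupport.intro isCompact_Icc hk.eq_zero

theorem deriv (hk : IsBump a b k) : IsBump a b (deriv k) := by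
  refine ⟨hk.contDiff.deriv', fun x hx => ?_⟩
  have h : k =ᶠ[nhds x] fun _ => 0 := by
    filter_upwards [isClosed_Icc.isOpen_compl.mem_nhds hx] with y hy using hk.eq_zero y hy
  rw [h.deriv_eq, deriv_const]

theorem hasDerivAt (hk : IsBump a b k) (x : ℝ) : HasDerivAt k (_root_.deriv k x) x :=
  (hk.contDiff.differentiable (by simp) x).hasDerivAt

theorem integrable_mul (hk : IsBump a b k) {f : ℝ → ℝ} (hf : Continuous f) :
    Integrable fun x => f x * k x :=
  (hf.mul hk.contDiff.continuous).integrable_of_hasCompactSupport hk.hasCompactSupport.mul_left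

theorem integrable_sq (hk : IsBump a b k) : Integrable fun x => k x ^ 2 := by
  simpa only [sq] using hk.integrable_mul hk.contDiff.continuous

theorem integrable_mul_deriv (hk : IsBump a b k) : Integrable fun x => k x * _root_.deriv k x :=
  hk.deriv.integrable_mul hk.contDiff.continuous

theorem integral_mul_deriv (hk : IsBump a b k) : ∫ x, k x * _root_.deriv k x = 0 := by
  have h := integral_eq_zero_of_hasDerivAt_of_integrable (f := fun x => k x * k x)
    (f' := fun x => 2 * (k x * _root_.deriv k x))
    (fun x => ((hk.hasDerivAt x).mul (hk.hasDerivAt x)).congr_deriv (by ring))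
    (hk.integrable_mul_deriv.const_mul 2) (by simpa only [sq] using hk.integrable_sq)
  rw [integral_const_mul] at h
  linarith

theorem shift (hk : IsBump a b k) (c : ℝ) : IsBump (a - c) (b - c) fun x => k (c + x) :=
  ⟨hk.contDiff.comp (by fun_prop), fun x hx => hk.eq_zero _ fun h =>
    hx ⟨by linarith [h.1], by linarith [h.2]⟩⟩

theorem dilate (hk : IsBump a b k) {M : ℝ} (hM : 0 < M) :
    IsBump (M * a) (M * b) fun x => k (M⁻¹ * x) :=
  ⟨hk.contDiff.comp (by fun_prop), fun x hx => hk.eq_zero _ fun h =>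
    hx ⟨by have := h.1; rwa [inv_mul_eq_div, le_div_iff₀' hM] at this,
      by have := h.2; rwa [inv_mul_eq_div, div_le_iff₀' hM] at this⟩⟩

end IsBump

theorem integral_eq_integral_exp {F : ℝ → ℝ} (hF : ∀ s ≤ 0, F s = 0) :
    ∫ s, F s = ∫ y, Real.exp y * F (Real.exp y) := by
  have h := integral_image_eq_integral_abs_deriv_smul (f := Real.exp) (f' := Real.exp)
    MeasurableSet.univ (fun x _ => (Real.hasDerivAt_exp x).hasDerivWithinAt)
    Real.exp_injective.injOn F
  rw [Set.image_univ, Real.range_exp, setIntegral_univ] at h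
  rw [← setIntegral_eq_integral_of_forall_compl_eq_zero (s := Set.Ioi 0)
    fun s hs => hF s (not_lt.1 hs), h]
  simp only [Real.abs_exp, smul_eq_mul]

/-- The substitution `v(s) = s^{1/2} k(log s)` of the one-dimensional Hardy inequality. -/
noncomputable def logLift (k : ℝ → ℝ) (s : ℝ) : ℝ := √s * k (Real.log s)

theorem logLift_exp (k : ℝ → ℝ) (y : ℝ) : logLift k (Real.exp y) = Real.exp (y / 2) * k y := by
  rw [logLift, Real.log_exp, Real.exp_half]

section logLift

variable {a b : ℝ} {k : ℝ → ℝ}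

theorem logLift_eq_zero (hk : IsBump a b k) {s : ℝ} (hs : s ∉ Set.Icc (Real.exp a) (Real.exp b)) :
    logLift k s = 0 := by
  rcases le_or_gt s 0 with h | h
  · simp [logLift, Real.sqrt_eq_zero_of_nonpos h]
  · rw [logLift, hk.eq_zero, mul_zero]
    exact fun h' => hs ⟨(Real.le_log_iff_exp_le h).1 h'.1, (Real.log_le_iff_le_exp h).1 h'.2⟩

theorem IsBump.logLift (hk : IsBump a b k) : IsBump (Real.exp a) (Real.exp b) (logLift k) := by
  refine ⟨contDiff_iff_contDiffAt.2 fun s => ?_, fun s hs => logLift_eq_zero hk hs⟩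
  rcases le_or_gt s 0 with h | h
  · have : _root_.logLift k =ᶠ[nhds s] fun _ => 0 := by
      filter_upwards [Iio_mem_nhds (h.trans_lt (Real.exp_pos a))] with t ht
      exact logLift_eq_zero hk fun h' => absurd h'.1 (not_le.2 ht)
    exact contDiffAt_const.congr_of_eventuallyEq this
  · exact (Real.contDiffAt_sqrt h.ne').mul
      (hk.contDiff.contDiffAt.comp s (Real.contDiffAt_log.2 h.ne'))

theorem hasDerivAt_logLift {k' s : ℝ} (hk : HasDerivAt k k' (Real.log s)) (hs : 0 < s) :
    HasDerivAt (logLift k) ((√s)⁻¹ * (k (Real.log s) / 2 + k')) s := by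
  have h := (Real.hasDerivAt_sqrt hs.ne').mul (hk.comp s (Real.hasDerivAt_log hs.ne'))
  refine h.congr_deriv ?_
  have h1 : √s ≠ 0 := (Real.sqrt_pos.2 hs).ne'
  have h2 : s = √s ^ 2 := (Real.sq_sqrt hs.le).symm
  simp only [Function.comp]
  generalize k (Real.log s) = c
  generalize √s = q at *
  subst h2
  field_simp

theorem deriv_logLift (hk : IsBump a b k) {s : ℝ} (hs : 0 < s) :
    deriv (logLift k) s = (√s)⁻¹ * (k (Real.log s) / 2 + deriv k (Real.log s)) :=
  (hasDerivAt_logLift (hk.hasDerivAt _) hs).deriv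

theorem deriv_deriv_logLift (hk : IsBump a b k) {s : ℝ} (hs : 0 < s) :
    deriv (deriv (logLift k)) s =
      (√s)⁻¹ ^ 3 * (deriv (deriv k) (Real.log s) - k (Real.log s) / 4) := by
  have he : deriv (logLift k) =ᶠ[nhds s]
      fun s => (√s)⁻¹ * (k (Real.log s) / 2 + deriv k (Real.log s)) := by
    filter_upwards [Ioi_mem_nhds hs] with t ht using deriv_logLift hk ht
  rw [he.deriv_eq]
  have h1 : √s ≠ 0 := (Real.sqrt_pos.2 hs).ne'
  have h := ((Real.hasDerivAt_sqrt hs.ne').inv h1).mul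
    (((hk.hasDerivAt _).comp s (Real.hasDerivAt_log hs.ne')).div_const 2 |>.add
      ((hk.deriv.hasDerivAt _).comp s (Real.hasDerivAt_log hs.ne')))
  refine (h.congr_deriv ?_).deriv
  have h2 : s = √s ^ 2 := (Real.sq_sqrt hs.le).symm
  simp only [Function.comp, Pi.inv_apply, Pi.add_apply]
  generalize k (Real.log s) = c
  generalize deriv k (Real.log s) = c
  generalize deriv (deriv k) (Real.log s) = c
  generalize √s = q at *
  subst h2
  field_simp
  ring

theorem deriv_logLift_exp (hk : IsBump a b k) (y : ℝ) :
    deriv (logLift k) (Real.exp y) = Real.exp (-(y / 2)) * (k y / 2 + deriv k y) := by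
  rw [deriv_logLift hk (Real.exp_pos y), Real.log_exp, ← Real.exp_half, Real.exp_neg]

theorem deriv_deriv_logLift_exp (hk : IsBump a b k) (y : ℝ) :
    deriv (deriv (logLift k)) (Real.exp y) =
      Real.exp (-(3 * y / 2)) * (deriv (deriv k) y - k y / 4) := by
  rw [deriv_deriv_logLift hk (Real.exp_pos y), Real.log_exp, ← Real.exp_half, ← Real.exp_neg,
    ← Real.exp_nat_mul]
  congr 2
  push_cast; ring

theorem IsBump.eq_zero_of_nonpos (hk : IsBump (Real.exp a) b k) {s : ℝ} (hs : s ≤ 0) : k s = 0 :=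
  hk.eq_zero s fun h => absurd (h.1.trans hs) (not_le.2 (Real.exp_pos a))

/-- Hardy's inequality with its exact deficit: the cross term k k′ is a total derivative and
integrates to zero, while ∫k² is the Hardy integral of s⁻²v² for v = `logLift k`. -/
theorem integral_deriv_logLift_sq (hk : IsBump a b k) :
    4 * ∫ s, deriv (logLift k) s ^ 2 = (∫ y, k y ^ 2) + 4 * ∫ y, deriv k y ^ 2 := by
  rw [integral_eq_integral_exp fun s hs => by simp [hk.logLift.deriv.eq_zero_of_nonpos hs]]
  have h : ∀ y, Real.exp y * deriv (logLift k) (Real.exp y) ^ 2 =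
      1 / 4 * k y ^ 2 + deriv k y ^ 2 + k y * deriv k y := fun y => by
    rw [deriv_logLift_exp hk, mul_pow, ← mul_assoc, ← Real.exp_nat_mul, ← Real.exp_add]
    have : y + ((2 : ℕ) : ℝ) * -(y / 2) = 0 := by push_cast; ring
    rw [this, Real.exp_zero]; ring
  simp only [h]
  have hi : Integrable fun y => 1 / 4 * k y ^ 2 := hk.integrable_sq.const_mul _
  have hi' : Integrable fun y => 1 / 4 * k y ^ 2 + deriv k y ^ 2 := hi.add hk.deriv.integrable_sq
  rw [integral_add hi' hk.integrable_mul_deriv, integral_add hi hk.deriv.integrable_sq,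
    hk.integral_mul_deriv, integral_const_mul]
  ring

theorem integral_mul_logLift_sq (hk : IsBump a b k) (F : ℝ → ℝ) :
    ∫ s, F s * logLift k s ^ 2 = ∫ y, F (Real.exp y) * Real.exp (2 * y) * k y ^ 2 := by
  rw [integral_eq_integral_exp fun s hs => by simp [hk.logLift.eq_zero_of_nonpos hs]]
  refine integral_congr_ae (.of_forall fun y => ?_)
  simp only [logLift_exp, mul_pow, ← Real.exp_nat_mul]
  have : Real.exp (2 * y) = Real.exp y * Real.exp (((2 : ℕ) : ℝ) * (y / 2)) := by
    rw [← Real.exp_add]; push_cast; ring_nf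
  rw [this]; ring

end logLift

/-! ### The iterated substitution. -/

/-- The iterated substitution `v(s) = s^{1/2} (1 + log s)^{1/2} k(log (1 + log s))`. -/
noncomputable def logLogLift (k : ℝ → ℝ) : ℝ → ℝ := logLift fun t => logLift k (1 + t)

section logLogLift

variable {a b : ℝ} {k : ℝ → ℝ}

theorem IsBump.logLogLift (hk : IsBump a b k) :
    IsBump (Real.exp (Real.exp a - 1)) (Real.exp (Real.exp b - 1)) (logLogLift k) :=
  (hk.logLift.shift 1).logLift

/-- The deficit of the first Hardy substitution is 4∫w′² with w = `logLift k`, to which the same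
identity applies again. -/
theorem integral_deriv_logLogLift_sq (hk : IsBump a b k) :
    4 * ∫ s, deriv (logLogLift k) s ^ 2 =
      (∫ s, (s ^ 2)⁻¹ * logLogLift k s ^ 2) + (∫ y, k y ^ 2) + 4 * ∫ y, deriv k y ^ 2 := by
  rw [logLogLift, integral_deriv_logLift_sq (hk.logLift.shift 1),
    integral_mul_logLift_sq (hk.logLift.shift 1), add_assoc, ← integral_deriv_logLift_sq hk]
  congr 1
  · refine integral_congr_ae (.of_forall fun y => ?_)
    simp only [← Real.exp_nat_mul, Nat.cast_ofNat, inv_mul_cancel₀ (Real.exp_pos _).ne', one_mul]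
  · have hd : deriv (fun t => logLift k (1 + t)) = fun t => deriv (logLift k) (1 + t) :=
      funext fun t => deriv_comp_const_add ..
    rw [hd, integral_add_left_eq_self fun y => deriv (logLift k) y ^ 2]

theorem integral_weight_logLogLift_sq (hk : IsBump a b k) (γ : ℝ) :
    ∫ s, (s ^ 2 * (1 + Real.log s) ^ γ)⁻¹ * logLogLift k s ^ 2 =
      ∫ y, Real.exp ((2 - γ) * y) * k y ^ 2 := by
  rw [logLogLift, integral_mul_logLift_sq (hk.logLift.shift 1)]
  have h : ∀ y, ((Real.exp y ^ 2 * (1 + Real.log (Real.exp y)) ^ γ)⁻¹ * Real.exp (2 * y)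
      * logLift k (1 + y) ^ 2) = (fun t => (t ^ γ)⁻¹ * logLift k t ^ 2) (1 + y) := fun y => by
    have : Real.exp (2 * y) = Real.exp y ^ 2 := by rw [← Real.exp_nat_mul]; norm_cast
    rw [this, Real.log_exp, mul_inv]
    have := (Real.exp_pos y).ne'
    field_simp
  simp only [h]
  rw [integral_add_left_eq_self fun t => (t ^ γ)⁻¹ * logLift k t ^ 2,
    integral_mul_logLift_sq hk]
  refine integral_congr_ae (.of_forall fun y => ?_)
  simp only [← Real.exp_mul, ← Real.exp_neg, ← Real.exp_add]
  ring_nf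

/-- Each second derivative of a lift gains a negative power of s, which is doubly exponential in the
variable of k. The crude factor exp(−a) is all that is needed to make this term vanish as the
support moves to infinity. -/
theorem integral_deriv_deriv_logLogLift_sq_le (hk : IsBump a b k) (ha : 1 ≤ a) :
    ∫ s, deriv (deriv (logLogLift k)) s ^ 2 ≤
      Real.exp (-a) * (2 * (∫ y, deriv (deriv k) y ^ 2) + 2 * ∫ y, k y ^ 2) := by
  have hw := hk.logLift
  have hw1 := hw.shift 1
  rw [integral_eq_integral_exp fun s hs => by
    simp [hk.logLogLift.deriv.deriv.eq_zero_of_nonpos hs]]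
  have h1 : ∀ y, Real.exp y * deriv (deriv (logLogLift k)) (Real.exp y) ^ 2 =
      (fun t => Real.exp (-(2 * (t - 1))) *
        (deriv (deriv (logLift k)) t - logLift k t / 4) ^ 2) (1 + y) := fun y => by
    rw [logLogLift, deriv_deriv_logLift_exp hw1, mul_pow, ← mul_assoc, ← Real.exp_nat_mul,
      ← Real.exp_add]
    have hd : deriv (fun t => logLift k (1 + t)) = fun t => deriv (logLift k) (1 + t) :=
      funext fun t => deriv_comp_const_add ..
    rw [hd, deriv_comp_const_add]
    congr 2
    push_cast; ring
  simp only [h1]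
  rw [integral_add_left_eq_self fun t => Real.exp (-(2 * (t - 1))) *
        (deriv (deriv (logLift k)) t - logLift k t / 4) ^ 2,
    integral_eq_integral_exp fun s hs => by
      simp [hw.deriv.deriv.eq_zero_of_nonpos hs, hw.eq_zero_of_nonpos hs]]
  have hint := ((hk.deriv.deriv.integrable_sq.const_mul 2).add (hk.integrable_sq.const_mul 2)
    ).const_mul (Real.exp (-a))
  rw [← integral_const_mul, ← integral_const_mul,
    ← integral_add (hk.deriv.deriv.integrable_sq.const_mul 2) (hk.integrable_sq.const_mul 2),
    ← integral_const_mul]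
  refine integral_mono_of_nonneg (.of_forall fun y => by positivity) hint (.of_forall fun y => ?_)
  simp only [deriv_deriv_logLift_exp hk, logLift_exp]
  by_cases hy : y ∈ Set.Icc a b
  · have hy1 : 1 ≤ y := ha.trans hy.1
    generalize deriv (deriv k) y = p
    generalize k y = q
    have e1 : Real.exp (-(3 * y / 2)) * (p - q / 4) - Real.exp (y / 2) * q / 4 =
        Real.exp (y / 2) * (Real.exp (-(2 * y)) * (p - q / 4) - q / 4) := by
      have : Real.exp (-(3 * y / 2)) = Real.exp (y / 2) * Real.exp (-(2 * y)) := by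
        rw [← Real.exp_add]; ring_nf
      rw [this]; ring
    rw [e1, mul_pow, ← Real.exp_nat_mul]
    have hc0 := Real.exp_pos (-(2 * y))
    have hc1 : Real.exp (-(2 * y)) ≤ 1 := Real.exp_le_one_iff.2 (by linarith)
    generalize Real.exp (-(2 * y)) = c at *
    have hsq : (c * (p - q / 4) - q / 4) ^ 2 ≤ 2 * p ^ 2 + 2 * q ^ 2 := by
      have hcc : c ^ 2 ≤ 1 := by nlinarith
      have hcc' : (c + 1) ^ 2 ≤ 4 := by nlinarith
      calc (c * (p - q / 4) - q / 4) ^ 2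
          ≤ 2 * (c ^ 2 * p ^ 2) + 2 * ((c + 1) ^ 2 * (q / 4) ^ 2) := by
            nlinarith [sq_nonneg (c * p + (c + 1) * (q / 4))]
        _ ≤ 2 * (1 * p ^ 2) + 2 * (4 * (q / 4) ^ 2) := by gcongr
        _ ≤ 2 * p ^ 2 + 2 * q ^ 2 := by nlinarith [sq_nonneg q]
    have hexp : Real.exp y * (Real.exp (-(2 * (Real.exp y - 1))) *
        Real.exp (((2 : ℕ) : ℝ) * (y / 2))) ≤ Real.exp (-a) := by
      rw [← Real.exp_add, ← Real.exp_add]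
      refine Real.exp_le_exp.2 ?_
      -- The exponent is 2y + 2 − 2exp(y) ≤ −y² by the quadratic bound, and y² ≥ y ≥ a because y ≥
      -- 1.
      have := Real.quadratic_le_exp_of_nonneg (x := y) (by linarith)
      push_cast
      nlinarith [hy.1]
    calc _ = (Real.exp y * (Real.exp (-(2 * (Real.exp y - 1))) *
        Real.exp (((2 : ℕ) : ℝ) * (y / 2)))) * (c * (p - q / 4) - q / 4) ^ 2 := by ring
      _ ≤ _ := by gcongr
  · simp [hk.eq_zero y hy, hk.deriv.deriv.eq_zero y hy]

end logLogLift

/-! ### Radial functions and reduction to the line. -/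

/-- Polar coordinates: the volume factor r³ dr against r⁻⁴ leaves dr/r, the translation-invariant
measure in log r. The constant is the area of the unit sphere. -/
theorem exists_integral_norm_eq : ∃ C > 0, ∀ (H : ℝ → ℝ) (L : ℝ),
    ∫ x : R4, (‖x‖ ^ 4)⁻¹ * H (L - Real.log ‖x‖) = C * ∫ s, H s := by
  refine ⟨4 * (volume : Measure R4).real (Metric.ball 0 1), ?_, fun H L => ?_⟩
  · exact mul_pos (by norm_num) (ENNReal.toReal_pos (Metric.measure_ball_pos _ _ one_pos).ne'
      measure_ball_lt_top.ne)
  have h := integral_fun_norm_addHaar (volume : Measure R4)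
    fun r => (r ^ 4)⁻¹ * H (L - Real.log r)
  rw [h]
  simp only [finrank_euclideanSpace, Fintype.card_fin, nsmul_eq_mul, smul_eq_mul]
  rw [← integral_indicator measurableSet_Ioi,
    integral_eq_integral_exp fun s hs => by simp [hs],
    ← integral_sub_left_eq_self H volume L, ← mul_assoc]
  congr 1
  refine integral_congr_ae (.of_forall fun y => ?_)
  have := (Real.exp_pos y).ne'
  simp [Set.indicator, Real.exp_pos]
  field_simp

theorem laplacian_comp_log_norm {v : ℝ → ℝ} (hv : ContDiff ℝ ∞ v) (L : ℝ) {x : R4} (hx : x ≠ 0) :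
    Δ (fun y : R4 => v (L - Real.log ‖y‖)) x =
      (‖x‖ ^ 2)⁻¹ * (deriv (deriv v) (L - Real.log ‖x‖) - 2 * deriv v (L - Real.log ‖x‖)) := by
  have hv' : ContDiff ℝ ∞ (deriv v) := hv.deriv'
  have hlog : ∀ (i : Fin 4) {y : R4}, y ≠ 0 →
      HasPd i (fun y : R4 => L - Real.log ‖y‖) (0 - y i * (‖y‖ ^ 2)⁻¹) y := fun i y hy =>
    (HasPd.const L).sub (HasPd.log_norm hy)
  have h1 : ∀ (i : Fin 4) {y : R4}, y ≠ 0 → HasPd i (fun y : R4 => v (L - Real.log ‖y‖))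
      (deriv v (L - Real.log ‖y‖) * (0 - y i * (‖y‖ ^ 2)⁻¹)) y := fun i y hy =>
    HasPd.comp (f := fun y : R4 => L - Real.log ‖y‖)
      (hv.differentiable (by simp) _).hasDerivAt (hlog i hy)
  have h2 : ∀ i : Fin 4, HasPd i (pd i fun y : R4 => v (L - Real.log ‖y‖))
      (deriv (deriv v) (L - Real.log ‖x‖) * (0 - x i * (‖x‖ ^ 2)⁻¹) * (0 - x i * (‖x‖ ^ 2)⁻¹) +
        deriv v (L - Real.log ‖x‖) *
          (0 - (1 * (‖x‖ ^ 2)⁻¹ + x i * (-2 * x i * ((‖x‖ ^ 2)⁻¹) ^ 2)))) x := fun i => by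
    have hxi : HasPd i (fun y : R4 => y i) 1 x := (HasPd.coord i).congr_val (by simp)
    have hd : HasPd i (fun y : R4 => deriv v (L - Real.log ‖y‖)) _ x :=
      HasPd.comp (f := fun y : R4 => L - Real.log ‖y‖)
        (hv'.differentiable (by simp) _).hasDerivAt (hlog i hx)
    refine (hd.mul ((HasPd.const 0).sub (hxi.mul (HasPd.inv_norm_sq hx)))).congr_of_eventuallyEq ?_
    filter_upwards [isOpen_ne.mem_nhds hx] with y hy using (h1 i hy).eq
  have hsm : ContDiffAt ℝ 2 (fun y : R4 => v (L - Real.log ‖y‖)) x :=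
    (hv.contDiffAt.of_le (by norm_cast)).comp x (contDiffAt_const.sub (contDiffAt_log_norm hx))
  rw [laplacian_eq_sum_pd hsm, Finset.sum_congr rfl fun i _ => (h2 i).eq]
  have hq : (‖x‖ ^ 2)⁻¹ * ∑ j, x j ^ 2 = 1 := by
    have h : ‖x‖ ^ 2 = ∑ j, x j ^ 2 := by
      rw [EuclideanSpace.norm_sq_eq]; simp
    rw [← h]; exact inv_mul_cancel₀ (pow_ne_zero 2 (norm_ne_zero_iff.2 hx))
  generalize (‖x‖ ^ 2)⁻¹ = ρ at *
  simp only [Fin.sum_univ_four] at *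
  linear_combination (deriv (deriv v) (L - Real.log ‖x‖) * ρ
    + 2 * deriv v (L - Real.log ‖x‖) * ρ) * hq

/-- Since `Real.log 0 = 0`, the function takes the value v(L) at the origin, and `L < a` makes this
zero. The condition on ρ places the support inside the ball of radius ρ. -/
theorem IsBump.isTestFunction_comp_log_norm {a b : ℝ} {v : ℝ → ℝ} (hv : IsBump a b v)
    {L ρ : ℝ} (hρ : 0 < ρ) (hL : L < a) (hLρ : L - Real.log ρ < a) {Ω : Set R4}
    (hΩ : ∀ x : R4, ‖x‖ < ρ → x ∈ Ω) :
    IsTestFunction (Ω \ {0}) fun x : R4 => v (L - Real.log ‖x‖) := by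
  set K : Set R4 := {x | Real.exp (L - b) ≤ ‖x‖ ∧ ‖x‖ ≤ Real.exp (L - a)} with hK
  have hKc : IsClosed K :=
    (isClosed_le continuous_const continuous_norm).inter
      (isClosed_le continuous_norm continuous_const)
  have hKb : IsCompact K := by
    refine (isCompact_closedBall (0 : R4) (Real.exp (L - a))).of_isClosed_subset hKc ?_
    exact fun x hx => by simpa using hx.2
  have hz : ∀ x ∉ K, v (L - Real.log ‖x‖) = 0 := fun x hx => by
    by_contra h
    have hm : L - Real.log ‖x‖ ∈ Set.Icc a b := by_contra fun h' => h (hv.eq_zero _ h')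
    have hx0 : 0 < ‖x‖ := by
      rcases (norm_nonneg x).eq_or_lt with h0 | h0
      · rw [← h0, Real.log_zero, sub_zero] at hm
        exact absurd hm.1 (not_le.2 hL)
      · exact h0
    exact hx ⟨(Real.le_log_iff_exp_le hx0).1 (by linarith [hm.2]),
      (Real.log_le_iff_le_exp hx0).1 (by linarith [hm.1])⟩
  have hs : tsupport (fun x : R4 => v (L - Real.log ‖x‖)) ⊆ K :=
    closure_minimal (fun x hx => by_contra fun h => hx (hz x h)) hKc
  have hK0 : (0 : R4) ∉ K := fun h => absurd h.1 (by simp [Real.exp_pos])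
  refine ⟨contDiff_iff_contDiffAt.2 fun x => ?_, hKb.of_isClosed_subset (isClosed_tsupport _) hs,
    fun x hx => ⟨hΩ x ?_, fun h => hK0 (h ▸ hs hx)⟩⟩
  · by_cases hx : x = 0
    · have : (fun x : R4 => v (L - Real.log ‖x‖)) =ᶠ[nhds x] fun _ => 0 := by
        filter_upwards [hKc.isOpen_compl.mem_nhds (hx ▸ hK0 : x ∉ K)] with y hy using hz y hy
      exact contDiffAt_const.congr_of_eventuallyEq this
    · exact hv.contDiff.contDiffAt.comp x (contDiffAt_const.sub (contDiffAt_log_norm hx))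
  · refine (hs hx).2.trans_lt ?_
    rw [← Real.lt_log_iff_exp_lt hρ]
    linarith

open Filter Topology

/-- The cross term v′v″ is a total derivative. -/
theorem integral_rellich_eq {a b : ℝ} {v : ℝ → ℝ} (hv : IsBump a b v) :
    ∫ s, (deriv (deriv v) s - 2 * deriv v s) ^ 2 =
      (∫ s, deriv (deriv v) s ^ 2) + 4 * ∫ s, deriv v s ^ 2 := by
  have h : ∀ s, (deriv (deriv v) s - 2 * deriv v s) ^ 2 =
      deriv (deriv v) s ^ 2 + 4 * deriv v s ^ 2 - 4 * (deriv v s * deriv (deriv v) s) :=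
    fun s => by ring
  simp only [h]
  have h1 := hv.deriv.deriv.integrable_sq
  have h2 : Integrable fun s => 4 * deriv v s ^ 2 := hv.deriv.integrable_sq.const_mul 4
  have h12 : Integrable fun s => deriv (deriv v) s ^ 2 + 4 * deriv v s ^ 2 := h1.add h2
  rw [integral_sub h12 (hv.deriv.integrable_mul_deriv.const_mul 4), integral_add h1 h2,
    integral_const_mul, integral_const_mul, hv.deriv.integral_mul_deriv]
  ring

/-- The inequality restricted to radial functions, in the variable `s = 1 - log (|x| / R)`. -/
theorem line_inequality_of_rellich {a b : ℝ} {v : ℝ → ℝ} (hv : IsBump a b v) (ha : 1 ≤ a)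
    {R ρ : ℝ} (hR : 0 < R) (hρ : 0 < ρ) (hL : 1 + Real.log R < a)
    (hLρ : 1 + Real.log R - Real.log ρ < a) {Ω : Set R4} (hΩ : ∀ x : R4, ‖x‖ < ρ → x ∈ Ω)
    {D γ : ℝ}
    (H : ∀ u : R4 → ℝ, IsTestFunction (Ω \ {0}) u →
        (∫ x in Ω, (Δ u x) ^ 2) - (∫ x in Ω, |u x| ^ 2 / (‖x‖ ^ 4 * E₁ (‖x‖ / R) ^ 2)) ≥
          D * ∫ x in Ω, |u x| ^ 2 / (‖x‖ ^ 4 * E₁ (‖x‖ / R) ^ 2 * E₂ (‖x‖ / R) ^ γ)) :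
    D * (∫ s, (s ^ 2 * (1 + Real.log s) ^ γ)⁻¹ * v s ^ 2) +
      (∫ s, (s ^ 2)⁻¹ * v s ^ 2) ≤ (∫ s, deriv (deriv v) s ^ 2) + 4 * ∫ s, deriv v s ^ 2 := by
  obtain ⟨C, hC, hrad⟩ := exists_integral_norm_eq
  set L := 1 + Real.log R with hLdef
  have hu := hv.isTestFunction_comp_log_norm hρ hL hLρ hΩ
  have h := H _ hu
  have hz : ∀ x ∉ tsupport (fun x : R4 => v (L - Real.log ‖x‖)), v (L - Real.log ‖x‖) = 0 :=
    fun x hx => image_eq_zero_of_notMem_tsupport (f := fun x : R4 => v (L - Real.log ‖x‖)) hx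
  have hvL : v L = 0 := hv.eq_zero L fun h => absurd h.1 (not_le.2 hL)
  rw [hu.integral_laplacian_eq, hu.setIntegral_eq (fun x hx => by simp [hz x hx]),
    hu.setIntegral_eq (fun x hx => by simp [hz x hx])] at h
  have i1 : ∫ x : R4, (Δ (fun y : R4 => v (L - Real.log ‖y‖)) x) ^ 2 =
      C * ∫ s, (deriv (deriv v) s - 2 * deriv v s) ^ 2 := by
    rw [← hrad (fun s => (deriv (deriv v) s - 2 * deriv v s) ^ 2) L]
    refine integral_congr_ae ?_
    -- The radial formula for the Laplacian is available only off the origin, a null set.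
    filter_upwards [compl_mem_ae_iff.2 (measure_singleton (0 : R4))] with x hx
    rw [laplacian_comp_log_norm hv.contDiff L hx]
    ring
  have hE1 : ∀ x : R4, x ≠ 0 → E₁ (‖x‖ / R) = L - Real.log ‖x‖ := fun x hx =>
    E₁_div (norm_ne_zero_iff.2 hx) hR.ne'
  have i2 : ∫ x : R4, |v (L - Real.log ‖x‖)| ^ 2 / (‖x‖ ^ 4 * E₁ (‖x‖ / R) ^ 2) =
      C * ∫ s, (s ^ 2)⁻¹ * v s ^ 2 := by
    rw [← hrad (fun s => (s ^ 2)⁻¹ * v s ^ 2) L]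
    refine integral_congr_ae (.of_forall fun x => ?_)
    by_cases hx : x = 0
    · simp [hx]
    · simp only [hE1 x hx, sq_abs]
      simp only [div_eq_mul_inv, mul_inv]
      ring
  have i3 : ∫ x : R4, |v (L - Real.log ‖x‖)| ^ 2 /
        (‖x‖ ^ 4 * E₁ (‖x‖ / R) ^ 2 * E₂ (‖x‖ / R) ^ γ) =
      C * ∫ s, (s ^ 2 * (1 + Real.log s) ^ γ)⁻¹ * v s ^ 2 := by
    rw [← hrad (fun s => (s ^ 2 * (1 + Real.log s) ^ γ)⁻¹ * v s ^ 2) L]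
    refine integral_congr_ae (.of_forall fun x => ?_)
    by_cases hx : x = 0
    · simp [hx]
    by_cases hm : L - Real.log ‖x‖ ∈ Set.Icc a b
    · have : 0 < E₁ (‖x‖ / R) := by rw [hE1 x hx]; linarith [hm.1]
      simp only [E₂_eq this, hE1 x hx, sq_abs]
      simp only [div_eq_mul_inv, mul_inv]
      ring
    · simp [hv.eq_zero _ hm]
  rw [i1, i2, i3, integral_rellich_eq hv] at h
  refine le_of_mul_le_mul_left ?_ hC
  linarith

/-! ### Stretching the bump and the limit M → ∞. -/

/-- With k(x) = h(x/M), the integrals of k², k′², k″² scale as M, M⁻¹, M⁻³; the estimate is the line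
inequality divided by M. -/
theorem scaled_line_inequality {h : ℝ → ℝ} (hh : IsBump 1 2 h) {M D γ : ℝ} (hM : 1 ≤ M)
    (hD : 0 ≤ D) (hγ : γ ≤ 2) (hineq : ∀ k : ℝ → ℝ, IsBump M (M * 2) k →
      D * (∫ s, (s ^ 2 * (1 + Real.log s) ^ γ)⁻¹ * logLogLift k s ^ 2) +
        (∫ s, (s ^ 2)⁻¹ * logLogLift k s ^ 2) ≤
      (∫ s, deriv (deriv (logLogLift k)) s ^ 2) + 4 * ∫ s, deriv (logLogLift k) s ^ 2) :
    D * Real.exp ((2 - γ) * M) * (∫ x, h x ^ 2) ≤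
      (1 + 2 * Real.exp (-M)) * (∫ x, h x ^ 2) +
        (4 * (∫ x, deriv h x ^ 2) + 2 * ∫ x, deriv (deriv h) x ^ 2) / M := by
  have hM0 : 0 < M := by linarith
  set k : ℝ → ℝ := fun x => h (M⁻¹ * x) with hkdef
  have hk : IsBump M (M * 2) k := by simpa using hh.dilate hM0
  have hd1 : deriv k = fun x => M⁻¹ * deriv h (M⁻¹ * x) := funext fun x => by
    rw [hkdef, deriv_comp_mul_left, smul_eq_mul]
  have hd2 : deriv (deriv k) = fun x => M⁻¹ * (M⁻¹ * deriv (deriv h) (M⁻¹ * x)) :=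
    funext fun x => by
      rw [hd1, deriv_const_mul_field, deriv_comp_mul_left (f := deriv h), smul_eq_mul]
  have hscale : ∀ F : ℝ → ℝ, ∫ x, F (M⁻¹ * x) = M * ∫ x, F x := fun F => by
    rw [Measure.integral_comp_mul_left, inv_inv, abs_of_pos hM0, smul_eq_mul]
  have j0 : ∫ x, k x ^ 2 = M * ∫ x, h x ^ 2 := hscale fun x => h x ^ 2
  have j1 : ∫ x, deriv k x ^ 2 = M⁻¹ * ∫ x, deriv h x ^ 2 := by
    simp only [hd1, mul_pow]
    rw [integral_const_mul, hscale fun x => deriv h x ^ 2]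
    field_simp
  have j2 : ∫ x, deriv (deriv k) x ^ 2 = M⁻¹ ^ 3 * ∫ x, deriv (deriv h) x ^ 2 := by
    simp only [hd2, mul_pow]
    rw [integral_const_mul, integral_const_mul, hscale fun x => deriv (deriv h) x ^ 2]
    field_simp
  have hA : 0 ≤ ∫ x, h x ^ 2 := integral_nonneg fun x => sq_nonneg _
  have hB : 0 ≤ ∫ x, deriv h x ^ 2 := integral_nonneg fun x => sq_nonneg _
  have hC : 0 ≤ ∫ x, deriv (deriv h) x ^ 2 := integral_nonneg fun x => sq_nonneg _
  -- On the support y ≥ M, and γ ≤ 2 makes the exponential weight nondecreasing.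
  have hlow : Real.exp ((2 - γ) * M) * ∫ x, k x ^ 2 ≤
      ∫ y, Real.exp ((2 - γ) * y) * k y ^ 2 := by
    rw [← integral_const_mul]
    refine integral_mono (hk.integrable_sq.const_mul _) ?_ fun y => ?_
    · have := hk.integrable_mul (f := fun y => Real.exp ((2 - γ) * y) * k y)
        ((by fun_prop : Continuous fun y => Real.exp ((2 - γ) * y)).mul hk.contDiff.continuous)
      simpa only [sq, mul_assoc] using this
    · by_cases hy : y ∈ Set.Icc M (M * 2)
      · have := hy.1
        have h2 : 0 ≤ 2 - γ := by linarith
        simp only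
        gcongr
      · simp [hk.eq_zero y hy]
  have h1 := hineq k hk
  rw [integral_deriv_logLogLift_sq hk, integral_weight_logLogLift_sq hk] at h1
  have h2 := integral_deriv_deriv_logLogLift_sq_le hk hM
  rw [j0] at hlow
  rw [j0, j2] at h2
  rw [j0, j1] at h1
  generalize (∫ x, h x ^ 2) = A at *
  generalize (∫ x, deriv h x ^ 2) = B at *
  generalize (∫ x, deriv (deriv h) x ^ 2) = C at *
  have hinv : M⁻¹ ≤ 1 := inv_le_one_of_one_le₀ hM
  have hinv0 : 0 < M⁻¹ := inv_pos.2 hM0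
  have h3 := mul_le_mul_of_nonneg_left hlow hD
  have hexp : Real.exp (-M) ≤ 1 := Real.exp_le_one_iff.2 (by linarith)
  have h4 : Real.exp (-M) * (2 * (M⁻¹ ^ 3 * C)) ≤ 2 * C := by
    have h5 : M⁻¹ ^ 3 ≤ 1 := pow_le_one₀ hinv0.le hinv
    calc Real.exp (-M) * (2 * (M⁻¹ ^ 3 * C)) ≤ 1 * (2 * (1 * C)) := by gcongr
      _ = 2 * C := by ring
  have h5 : M⁻¹ * B ≤ B := by nlinarith
  refine le_of_mul_le_mul_left ?_ hM0
  have h6 : M * ((1 + 2 * Real.exp (-M)) * A + (4 * B + 2 * C) / M) =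
      M * A + 2 * Real.exp (-M) * (M * A) + 4 * B + 2 * C := by
    field_simp; ring
  rw [h6]
  nlinarith

theorem exists_isBump_one_two : ∃ h : ℝ → ℝ, IsBump 1 2 h ∧ 0 < ∫ x, h x ^ 2 := by
  let f : ContDiffBump (3 / 2 : ℝ) := ⟨1 / 4, 1 / 2, by norm_num, by norm_num⟩
  have hf : IsBump 1 2 f := by
    refine ⟨f.contDiff, fun x hx => ?_⟩
    refine f.zero_of_le_dist ?_
    by_contra! hlt
    rw [Real.dist_eq, abs_lt] at hlt
    have h1 : f.rOut = 1 / 2 := rfl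
    rw [h1] at hlt
    exact hx ⟨by linarith [hlt.1], by linarith [hlt.2]⟩
  refine ⟨f, hf, ?_⟩
  refine (hf.contDiff.continuous.pow 2).integral_pos_of_hasCompactSupport_nonneg_nonzero
    (x := 3 / 2) ?_ (fun x => sq_nonneg (f x)) ?_
  · simp only [sq]
    exact hf.hasCompactSupport.mul_left
  · have : f (3 / 2) = 1 := f.one_of_mem_closedBall (by simp [f.rIn_pos.le])
    simp [this]

theorem rellich_remainder_sharp {Ω : Set R4} (hopen : IsOpen Ω)
    (hbdd : Bornology.IsBounded Ω) (h0 : (0 : R4) ∈ Ω) {R : ℝ} (hR : outerRadius Ω ≤ R)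
    {D γ : ℝ} (hD : 0 < D)
    (H : ∀ u : R4 → ℝ, IsTestFunction (Ω \ {0}) u →
        (∫ x in Ω, (Δ u x) ^ 2) - (∫ x in Ω, |u x| ^ 2 / (‖x‖ ^ 4 * E₁ (‖x‖ / R) ^ 2)) ≥
          D * ∫ x in Ω, |u x| ^ 2 / (‖x‖ ^ 4 * E₁ (‖x‖ / R) ^ 2 * E₂ (‖x‖ / R) ^ γ)) :
    2 ≤ γ ∧ (γ = 2 → D ≤ 1) := by
  have hRpos := pos_of_outerRadius_le hopen h0 hbdd hR
  obtain ⟨ρ, hρ, hΩ⟩ := exists_pos_norm_mem hopen h0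
  obtain ⟨h, hh, hA⟩ := exists_isBump_one_two
  have hlarge : Tendsto (fun M : ℝ => Real.exp (Real.exp M - 1)) atTop atTop :=
    Real.tendsto_exp_atTop.comp (tendsto_atTop_add_const_right _ _ Real.tendsto_exp_atTop)
  have hev : γ ≤ 2 → ∀ᶠ M : ℝ in atTop, D * Real.exp ((2 - γ) * M) ≤
      1 + 2 * Real.exp (-M) + (4 * (∫ x, deriv h x ^ 2) + 2 * ∫ x, deriv (deriv h) x ^ 2) /
        M / ∫ x, h x ^ 2 := by
    intro hγ
    -- The left end of the support of `logLogLift k` is exp(exp(M) − 1); it must exceed the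
    -- thresholds fixed by R and by the ball of radius ρ inside Ω.
    filter_upwards [eventually_ge_atTop 1, hlarge.eventually_gt_atTop (1 + Real.log R),
      hlarge.eventually_gt_atTop (1 + Real.log R - Real.log ρ), hlarge.eventually_ge_atTop 1]
      with M hM h1 h2 h3
    have := scaled_line_inequality hh hM hD.le hγ fun k hk =>
      line_inequality_of_rellich hk.logLogLift h3 hRpos hρ h1 h2 hΩ H
    rw [← sub_le_iff_le_add', le_div_iff₀ hA]
    linarith
  have hlim : Tendsto (fun M : ℝ => 1 + 2 * Real.exp (-M) +
      (4 * (∫ x, deriv h x ^ 2) + 2 * ∫ x, deriv (deriv h) x ^ 2) / M / ∫ x, h x ^ 2)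
      atTop (𝓝 1) := by
    have e1 := (Real.tendsto_exp_neg_atTop_nhds_zero.const_mul 2).const_add 1
    have e2 := ((tendsto_const_nhds (x := 4 * (∫ x, deriv h x ^ 2) +
      2 * ∫ x, deriv (deriv h) x ^ 2)).div_atTop tendsto_id).div_const (∫ x, h x ^ 2)
    simpa using e1.add e2
  refine ⟨?_, ?_⟩
  -- If γ < 2 the left side of `hev` is unbounded while the right side tends to 1.
  · by_contra! hlt
    have htop : Tendsto (fun M : ℝ => D * Real.exp ((2 - γ) * M)) atTop atTop :=
      (Real.tendsto_exp_atTop.comp (tendsto_id.const_mul_atTop (by linarith))).const_mul_atTop hD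
    obtain ⟨M, h1, h2, h3⟩ := ((hev hlt.le).and ((htop.eventually_gt_atTop 2).and
      (hlim.eventually_lt_const (by norm_num : (1 : ℝ) < 2)))).exists
    linarith
  · rintro rfl
    refine ge_of_tendsto hlim ?_
    filter_upwards [hev le_rfl] with M hM
    simpa using hM

theorem proposition2p3 (Ω : Set R4) (hopen : IsOpen Ω) (hconn : IsConnected Ω)
    (hbdd : Bornology.IsBounded Ω) (h0 : (0 : R4) ∈ Ω)
    (R : ℝ) (hR : outerRadius Ω ≤ R) :
    -- the inequality with remainder term
    (∀ u : R4 → ℝ, IsTestFunction (Ω \ {0}) u →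
      (∫ x in Ω, (Δ u x) ^ 2) - (∫ x in Ω, |u x| ^ 2 / (‖x‖ ^ 4 * E₁ (‖x‖ / R) ^ 2)) ≥
        ∫ x in Ω, |u x| ^ 2 / (‖x‖ ^ 4 * E₁ (‖x‖ / R) ^ 2 * E₂ (‖x‖ / R) ^ 2)) ∧
    -- sharpness of the exponent and of the constant; here `γ` is a real exponent
    (∀ D γ : ℝ, 0 < D →
      (∀ u : R4 → ℝ, IsTestFunction (Ω \ {0}) u →
        (∫ x in Ω, (Δ u x) ^ 2) - (∫ x in Ω, |u x| ^ 2 / (‖x‖ ^ 4 * E₁ (‖x‖ / R) ^ 2)) ≥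
          D * ∫ x in Ω, |u x| ^ 2 / (‖x‖ ^ 4 * E₁ (‖x‖ / R) ^ 2 * E₂ (‖x‖ / R) ^ γ)) →
      2 ≤ γ ∧ (γ = 2 → D ≤ 1)) ∧
    -- `1` is the best constant in the inequality with remainder term
    IsGreatest {D : ℝ | ∀ u : R4 → ℝ, IsTestFunction (Ω \ {0}) u →
      (∫ x in Ω, (Δ u x) ^ 2) - (∫ x in Ω, |u x| ^ 2 / (‖x‖ ^ 4 * E₁ (‖x‖ / R) ^ 2)) ≥
        D * ∫ x in Ω, |u x| ^ 2 / (‖x‖ ^ 4 * E₁ (‖x‖ / R) ^ 2 * E₂ (‖x‖ / R) ^ 2)} 1 := by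
  have main : ∀ u : R4 → ℝ, IsTestFunction (Ω \ {0}) u →
      (∫ x in Ω, (Δ u x) ^ 2) - (∫ x in Ω, |u x| ^ 2 / (‖x‖ ^ 4 * E₁ (‖x‖ / R) ^ 2)) ≥
        ∫ x in Ω, |u x| ^ 2 / (‖x‖ ^ 4 * E₁ (‖x‖ / R) ^ 2 * E₂ (‖x‖ / R) ^ 2) := fun u hu => by
    linarith [rellich_remainder hopen hbdd h0 hR hu]
  refine ⟨main, fun D γ hD H => rellich_remainder_sharp hopen hbdd h0 hR hD H, ?_, ?_⟩
  · intro u hu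
    simpa using main u hu
  · intro D hDmem
    rcases le_or_gt D 0 with hD | hD
    -- Nonpositive D is below 1 trivially; the sharpness statement covers only positive D.
    · linarith
    · refine (rellich_remainder_sharp hopen hbdd h0 hR (γ := 2) hD fun u hu => ?_).2 rfl
      simpa only [Real.rpow_two] using hDmem u hu
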